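/- Let $P$ be a Markov transition kernel on a measurable space $\mathcal X$ that is reversible with respect to a probability measure $\pi$. For a Markov kernel $Q$ on $\mathcal X$ and $f\in L^2(\pi)$ put $\mathrm{Var}(f,Q):=\lim_{n\to\infty} n\,\mathrm{var}_\pi(\hat I_n)$, where $\hat I_n=\frac1n\sum_{i=0}^{n-1}f(X_i)$ and $(X_i)_{i\ge 0}$ is the Markov chain with $X_0\sim\pi$ and transition kernel $Q$; and call $Q$ variance bounding (with respect to $\pi$) if there is $K<\infty$ such that, for all $f\in L^2(\pi)$, the limit $\mathrm{Var}(f,Q)$ exists and $\mathrm{Var}(f,Q)\le K\,\mathrm{var}_\pi(f)$, where $\mathrm{var}_\pi(f)=\pi f^2-(\pi f)^2$. For a probability distribution $\mu$ on $\{0,1,2,\dots\}$ let $P_\mu:=\sum_{k=0}^\infty\mu(k)P^k$. Assume that $P$ is variance bounding. Then $P_\mu$ is variance bounding (with respect to $\pi$) if any of the following conditions holds: (i) $\mu_{\mathrm{odd}}:=\mu(\{1,3,5,\dots\})>0$; (ii) $\mu(0)<1$ and $P$ is geometrically ergodic, that is, there are $\rho\in[0,1)$ and $M:\mathcal X\to\mathbb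 R$ such that for $\pi$-almost every $x$ and all $n\ge 0$, $\|P^n(x,\cdot)-\pi\|:=\sup_{A}|P^n(x,A)-\pi(A)|\le M(x)\rho^n$, the supremum being over all measurable sets $A$. -/

import Mathlib

open MeasureTheory ProbabilityTheory Filter Topology
open scoped ENNReal

namespace TimeSampled

variable {X : Type*} [MeasurableSpace X]

theorem isMarkovKernel_pow (P : Kernel X X) [IsMarkovKernel P] (k : ℕ) :
    IsMarkovKernel (P ^ k) := by
  induction k with
  | zero => rw [pow_zero]; exact (inferInstance : IsMarkovKernel (Kernel.id : Kernel X X))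
  | succ k ih => rw [pow_succ]; exact (inferInstance : IsMarkovKernel ((P ^ k) ∘ₖ P))

/-- The time-sampled kernel `P_μ = ∑ₖ μ(k) P ^ k`; here `P ^ k` is the `k`-step kernel. -/
noncomputable def timeSampled (P : Kernel X X) (μ : Measure ℕ) : Kernel X X where
  toFun x := Measure.sum fun k : ℕ => μ {k} • (P ^ k) x
  measurable' := by
    refine Measure.measurable_of_measurable_coe _ fun s hs => ?_
    simp only [Measure.sum_apply _ hs, Measure.smul_apply, smul_eq_mul]
    exact Measurable.tsum fun k => ((P ^ k).measurable_coe hs).const_mul _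

instance isMarkovKernel_timeSampled (P : Kernel X X) [IsMarkovKernel P]
    (μ : Measure ℕ) [IsProbabilityMeasure μ] : IsMarkovKernel (timeSampled P μ) := by
  refine ⟨fun x => ⟨?_⟩⟩
  have hP := isMarkovKernel_pow P
  change (Measure.sum fun k : ℕ => μ {k} • (P ^ k) x) Set.univ = 1
  rw [Measure.sum_apply _ MeasurableSet.univ]
  simp only [Measure.smul_apply, measure_univ, smul_eq_mul, mul_one]
  have h := μ.tsum_indicator_apply_singleton Set.univ MeasurableSet.univ
  simpa using h

/-- The law on trajectories `ω : ℕ → X` of the Markov chain with initial distribution `π` and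
transition kernel `P`: given `ω 0, …, ω n`, the law of `ω (n + 1)` is `P (ω n)`. -/
noncomputable def chainLaw (P : Kernel X X) [IsMarkovKernel P] (π : Measure X) :
    Measure (ℕ → X) :=
  Kernel.trajMeasure (X := fun _ => X) π fun n : ℕ =>
    P.comap (fun ω : (i : Finset.Iic n) → X => ω ⟨n, Finset.mem_Iic.2 le_rfl⟩)
      (measurable_pi_apply _)

/-- The ergodic average `(1 / n) ∑_{i < n} f (X_i)` along a trajectory. -/
noncomputable def ergodicAverage (f : X → ℝ) (n : ℕ) (ω : ℕ → X) : ℝ :=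
  (1 / (n : ℝ)) * ∑ i ∈ Finset.range n, f (ω i)

/-- `Var(f, P) = lim_n n var_π(Î_n)` exists, is finite and equals `v`. -/
def HasAsymptoticVariance (P : Kernel X X) [IsMarkovKernel P] (π : Measure X)
    (f : X → ℝ) (v : ℝ) : Prop :=
  Tendsto (fun n : ℕ => (n : ℝ) * variance (ergodicAverage f n) (chainLaw P π)) atTop (𝓝 v)

/-- `P` is variance bounding with respect to `π`: for some `K < ∞`, one has
`Var(f, P) ≤ K var_π(f)` for all `f ∈ L²(π)`. -/
def VarianceBounding (P : Kernel X X) [IsMarkovKernel P] (π : Measure X) : Prop :=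
  ∃ K : ℝ, ∀ f : X → ℝ, MemLp f 2 π →
    ∃ v : ℝ, HasAsymptoticVariance P π f v ∧ v ≤ K * variance f π

/-- Total variation distance of two probability measures, `sup_A |ν₁(A) - ν₂(A)|`. -/
noncomputable def tvDist (ν₁ ν₂ : Measure X) : ℝ :=
  ⨆ A : {A : Set X // MeasurableSet A}, |ν₁.real A.1 - ν₂.real A.1|

/-- `P` is geometrically ergodic with limit `π`: `‖P^n(x, ·) - π‖ ≤ M(x) ρ ^ n` for all `n`
and `π`-almost every `x`, with some `ρ < 1` and some finite-valued function `M`. -/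
def GeometricallyErgodic (P : Kernel X X) (π : Measure X) : Prop :=
  ∃ ρ : ℝ, 0 ≤ ρ ∧ ρ < 1 ∧ ∃ M : X → ℝ, ∀ᵐ x ∂π, ∀ n : ℕ, tvDist ((P ^ n) x) π ≤ M x * ρ ^ n

end TimeSampled

/-!
Let `Q` be a kernel with invariant law `π`, and let `T` be its transition operator on `L²(π)` with
the constants split off, `T f = Q f - π(f)` (`centeredOp`). It is a contraction, symmetric when `Q`
is reversible, and the proof translates everything into bounds on its quadratic form, without
spectral theory.

Stationarity gives `n var(Î_n) = var f + (2 / n) ⟪f, ∑_{0 ≤ j < i < n} T ^ (i - j) f⟫`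
(`variance_ergodicAverage`). From this, variance bounding is the same as a right spectral gap
`⟪f, T f⟫ ≤ r ‖f‖²` with `r < 1`:
* if all the limits exist, the uniform boundedness principle bounds the operators
  `n⁻¹ ∑_{0 ≤ j < i < n} T ^ (i - j)`, which without a gap would be of size about `n / 2` on
  almost eigenvectors of `T` with eigenvalue `1` (`VarianceBounding.exists_gap`);
* if there is a gap, `1 - T` is invertible by Lax–Milgram, and summing the geometric series shows
  that the limit exists and is at most `2 / (1 - r) * var f` (`varianceBounding_of_gap`).

The Dirichlet form `‖f‖² - ⟪f, Q f⟫` is half the integral of `(f x - f y) ^ 2` over the law of a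
transition, so that of `P_μ` is at least `μ {k}` times that of `P ^ k`. Hence a gap of a single
power `P ^ k` with `μ {k} > 0` is enough (`varianceBounding_timeSampled`). If some odd `k` has
positive weight, `⟪f, T ^ (2 m + 1) f⟫ = ⟪T ^ m f, T (T ^ m f)⟫` carries the gap of `P` over to
`P ^ k` (`inner_pow_odd_le`). If `P` is geometrically ergodic, `T` is a strict contraction
(`GeometricallyErgodic.exists_norm_centeredOp_le`): the correlations `⟪u, T ^ n u⟫` are `O(ρ ^ n)`
for a dense set of `u`, and `‖T ^ n u‖` is log-convex in `n`, which turns this decay into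
`‖T u‖ ≤ ρ ‖u‖`. Then every `k ≥ 1` will do.
-/

namespace TimeSampled

variable {X : Type*} [MeasurableSpace X]

/-! ### Quadratic forms of contractions of a Hilbert space -/

section Hilbert

open scoped InnerProductSpace

variable {H : Type*} [NormedAddCommGroup H] [InnerProductSpace ℝ H]

/-- The operator `∑_{0 ≤ j < i < n} T ^ (i - j)`, written with the inner sum reflected. Applied
to a transition operator it collects the off-diagonal covariances of `n` steps of the chain. -/
def lagSum (T : H →L[ℝ] H) (n : ℕ) : H →L[ℝ] H :=
  ∑ i ∈ Finset.range n, ∑ j ∈ Finset.range i, T ^ (j + 1)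

theorem inner_lagSum (T : H →L[ℝ] H) (n : ℕ) (f g : H) :
    ⟪f, lagSum T n g⟫_ℝ =
      ∑ i ∈ Finset.range n, ∑ j ∈ Finset.range i, ⟪f, (T ^ (j + 1)) g⟫_ℝ := by
  simp [lagSum, inner_sum]

theorem lagSum_mul_one_sub_sq (T : H →L[ℝ] H) (n : ℕ) :
    lagSum T n * (1 - T) ^ 2 = (n : ℝ) • (T * (1 - T)) - (T - T ^ (n + 1)) := by
  have geom (i : ℕ) : (∑ j ∈ Finset.range i, T ^ (j + 1)) * (1 - T) = T - T ^ (i + 1) := by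
    induction i with
    | zero => simp
    | succ i ih => rw [Finset.sum_range_succ, add_mul, ih]; noncomm_ring
  have key : lagSum T n * (1 - T) = (n : ℝ) • T - ∑ i ∈ Finset.range n, T ^ (i + 1) := by
    simp [lagSum, Finset.sum_mul, geom, ← Nat.cast_smul_eq_nsmul ℝ]
  rw [pow_two, ← mul_assoc, key, sub_mul, geom, smul_mul_assoc]

theorem pow_add_apply (T : H →L[ℝ] H) (k l : ℕ) (f : H) :
    (T ^ (k + l)) f = (T ^ k) ((T ^ l) f) := by
  rw [pow_add]; rfl

theorem norm_pow_apply_le {T : H →L[ℝ] H} (hT : ‖T‖ ≤ 1) (k : ℕ) (f : H) :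
    ‖(T ^ k) f‖ ≤ ‖f‖ := by
  refine ((T ^ k).le_opNorm f).trans ?_
  have h : ‖T ^ k‖ ≤ 1 := by
    rcases k.eq_zero_or_pos with rfl | hk
    · simpa [ContinuousLinearMap.one_def] using ContinuousLinearMap.norm_id_le (𝕜 := ℝ) (E := H)
    · exact (norm_pow_le' T hk).trans (pow_le_one₀ (norm_nonneg _) hT)
  exact mul_le_of_le_one_left (norm_nonneg _) h

theorem inner_pow_comm {T : H →L[ℝ] H} (hsymm : ∀ f g, ⟪T f, g⟫_ℝ = ⟪f, T g⟫_ℝ) (k : ℕ)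
    (f g : H) : ⟪(T ^ k) f, g⟫_ℝ = ⟪f, (T ^ k) g⟫_ℝ := by
  induction k generalizing f g with
  | zero => simp
  | succ k ih =>
    rw [pow_add_apply, ih, pow_one, hsymm, Nat.add_comm, pow_add_apply, pow_one]

theorem norm_pow_apply_sub_le {T : H →L[ℝ] H} (hT : ‖T‖ ≤ 1) (k : ℕ) (f : H) :
    ‖(T ^ k) f - f‖ ≤ k * ‖T f - f‖ := by
  induction k with
  | zero => simp
  | succ k ih =>
    have h : (T ^ (k + 1)) f - f = (T ^ k) (T f - f) + ((T ^ k) f - f) := by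
      rw [pow_add_apply, pow_one, map_sub]; abel
    rw [h]
    refine (norm_add_le _ _).trans ?_
    have := norm_pow_apply_le hT k (T f - f)
    rw [Nat.cast_add_one, add_one_mul]
    linarith

/-- For a contraction, a vector that almost attains the supremum `1` of the quadratic form is
almost an eigenvector of eigenvalue `1`. -/
theorem norm_apply_sub_sq_le {T : H →L[ℝ] H} (hT : ‖T‖ ≤ 1) (f : H) :
    ‖T f - f‖ ^ 2 ≤ 2 * (‖f‖ ^ 2 - ⟪f, T f⟫_ℝ) := by
  have h1 := norm_sub_sq_real (T f) f
  have h2 : ‖T f‖ ≤ ‖f‖ := by simpa using norm_pow_apply_le hT 1 f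
  have h3 : ‖T f‖ ^ 2 ≤ ‖f‖ ^ 2 := by gcongr
  rw [real_inner_comm] at h1
  linarith

/-- Pointwise boundedness of the quadratic forms of the symmetric operators `A i` implies
uniform boundedness of their norms: polarization and twice Banach–Steinhaus. -/
theorem exists_norm_le_of_inner_bounded [CompleteSpace H] {ι : Type*} (A : ι → H →L[ℝ] H)
    (hsymm : ∀ i f g, ⟪A i f, g⟫_ℝ = ⟪f, A i g⟫_ℝ)
    (hb : ∀ f, ∃ C, ∀ i, |⟪f, A i f⟫_ℝ| ≤ C) : ∃ C, ∀ i, ‖A i‖ ≤ C := by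
  refine banach_steinhaus fun g => ?_
  have h : ∃ C, ∀ i, ‖innerSL ℝ (A i g)‖ ≤ C := by
    refine banach_steinhaus fun f => ?_
    obtain ⟨C₁, h₁⟩ := hb (f + g)
    obtain ⟨C₂, h₂⟩ := hb (f - g)
    refine ⟨C₁ + C₂, fun i => ?_⟩
    have e : 4 * ⟪A i g, f⟫_ℝ = ⟪f + g, A i (f + g)⟫_ℝ - ⟪f - g, A i (f - g)⟫_ℝ := by
      have := hsymm i g f
      have h3 := real_inner_comm f (A i g)
      simp only [map_add, map_sub, inner_add_left, inner_add_right, inner_sub_left,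
        inner_sub_right]
      linarith
    have a₁ := abs_le.1 (h₁ i)
    have a₂ := abs_le.1 (h₂ i)
    rw [innerSL_apply_apply, Real.norm_eq_abs, abs_le]
    constructor <;> linarith
  simpa using h

/-- If the normalized quadratic forms of `lagSum T n` converge, then the quadratic form of `T`
is bounded away from `1`. Otherwise there would be almost eigenvectors of eigenvalue `1`, on
which `n⁻¹ * lagSum T n` is of size about `n / 2`, against the uniform boundedness principle. -/
theorem exists_gap_of_tendsto_lagSum [CompleteSpace H] {T : H →L[ℝ] H} (hT : ‖T‖ ≤ 1)
    (hsymm : ∀ f g, ⟪T f, g⟫_ℝ = ⟪f, T g⟫_ℝ)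
    (hlim : ∀ f, ∃ v, Tendsto (fun n : ℕ => (n : ℝ)⁻¹ * ⟪f, lagSum T n f⟫_ℝ) atTop (𝓝 v)) :
    ∃ r < 1, ∀ f, ⟪f, T f⟫_ℝ ≤ r * ‖f‖ ^ 2 := by
  obtain ⟨C, hC⟩ : ∃ C, ∀ n : ℕ, ‖(n : ℝ)⁻¹ • lagSum T n‖ ≤ C := by
    refine exists_norm_le_of_inner_bounded _ (fun n f g => ?_) fun f => ?_
    · have h : ⟪lagSum T n f, g⟫_ℝ = ⟪f, lagSum T n g⟫_ℝ := by
        rw [← real_inner_comm, inner_lagSum, inner_lagSum]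
        refine Finset.sum_congr rfl fun i _ => Finset.sum_congr rfl fun j _ => ?_
        rw [real_inner_comm, inner_pow_comm hsymm]
      simp [real_inner_smul_left, real_inner_smul_right, h]
    · obtain ⟨v, hv⟩ := hlim f
      obtain ⟨C, hC⟩ := hv.norm.bddAbove_range
      refine ⟨C, fun n => ?_⟩
      have := hC (Set.mem_range_self n)
      simpa [real_inner_smul_right] using this
  obtain ⟨N, hN⟩ := exists_nat_gt (4 * C)
  by_contra! hcon
  -- `f` is an approximate eigenvector, precise enough that `⟪f, T ^ k f⟫ ≥ ‖f‖² / 2`, `k ≤ N + 1`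
  obtain ⟨f, hf⟩ := hcon (1 - 1 / (8 * ((N : ℝ) + 1) ^ 2)) (by
    have : (0 : ℝ) < 1 / (8 * ((N : ℝ) + 1) ^ 2) := by positivity
    linarith)
  have hε : ((N : ℝ) + 1) * ‖T f - f‖ ≤ ‖f‖ / 2 := by
    refine abs_le_of_sq_le_sq' ?_ (by positivity) |>.2
    have h1 := norm_apply_sub_sq_le hT f
    have h2 : ‖T f - f‖ ^ 2 ≤ 2 * (1 / (8 * ((N : ℝ) + 1) ^ 2) * ‖f‖ ^ 2) := by linarith
    calc (((N : ℝ) + 1) * ‖T f - f‖) ^ 2 = ((N : ℝ) + 1) ^ 2 * ‖T f - f‖ ^ 2 := by ring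
      _ ≤ ((N : ℝ) + 1) ^ 2 * (2 * (1 / (8 * ((N : ℝ) + 1) ^ 2) * ‖f‖ ^ 2)) := by gcongr
      _ = (‖f‖ / 2) ^ 2 := by field_simp; norm_num
  have hfpos : 0 < ‖f‖ := by
    refine (norm_nonneg f).lt_of_ne fun h0 => ?_
    have : f = 0 := norm_eq_zero.1 h0.symm
    simp [this] at hf
  have hterm (k : ℕ) (hk : k ≤ N + 1) : ‖f‖ ^ 2 / 2 ≤ ⟪f, (T ^ k) f⟫_ℝ := by
    have h1 : |⟪f, (T ^ k) f - f⟫_ℝ| ≤ ‖f‖ * (‖f‖ / 2) := by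
      refine (abs_real_inner_le_norm _ _).trans ?_
      gcongr
      refine (norm_pow_apply_sub_le hT k f).trans (le_trans ?_ hε)
      gcongr
      exact_mod_cast hk
    rw [inner_sub_right, real_inner_self_eq_norm_sq] at h1
    nlinarith [(abs_le.1 h1).1]
  have hsum : ((N : ℝ) + 1) * N / 4 * ‖f‖ ^ 2 ≤ ⟪f, lagSum T (N + 1) f⟫_ℝ := by
    rw [inner_lagSum]
    have h1 : ∑ i ∈ Finset.range (N + 1), ∑ j ∈ Finset.range i, ‖f‖ ^ 2 / 2 ≤
        ∑ i ∈ Finset.range (N + 1), ∑ j ∈ Finset.range i, ⟪f, (T ^ (j + 1)) f⟫_ℝ := by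
      refine Finset.sum_le_sum fun i hi => Finset.sum_le_sum fun j hj => hterm _ ?_
      simp only [Finset.mem_range] at hi hj
      lia
    refine le_trans (le_of_eq ?_) h1
    have h2 : (∑ i ∈ Finset.range (N + 1), (i : ℝ)) * 2 = ((N : ℝ) + 1) * N := by
      have := Finset.sum_range_id_mul_two (N + 1)
      rw [Nat.add_sub_cancel] at this
      simpa using congrArg (Nat.cast (R := ℝ)) this
    simp only [Finset.sum_const, Finset.card_range, nsmul_eq_mul, ← Finset.sum_mul]
    rw [← h2]
    ring
  have hup : ⟪f, lagSum T (N + 1) f⟫_ℝ ≤ ((N : ℝ) + 1) * C * ‖f‖ ^ 2 := by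
    have h1 : ⟪f, ((((N + 1 : ℕ) : ℝ))⁻¹ • lagSum T (N + 1)) f⟫_ℝ ≤ ‖f‖ * (C * ‖f‖) :=
      (real_inner_le_norm _ _).trans
        (mul_le_mul_of_nonneg_left (ContinuousLinearMap.le_of_opNorm_le _ (hC _) _)
          (norm_nonneg _))
    rw [smul_apply, real_inner_smul_right, inv_mul_le_iff₀ (by positivity)]
      at h1
    push_cast at h1
    linarith
  have h3 : ((N : ℝ) + 1) * ‖f‖ ^ 2 * (N - 4 * C) ≤ 0 := by linarith
  have h4 : 0 < ((N : ℝ) + 1) * ‖f‖ ^ 2 * (N - 4 * C) := by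
    have : 0 < (N : ℝ) - 4 * C := by linarith
    positivity
  linarith

/-- A quadratic form bounded away from `1` makes `1 - T` bijective, by Lax–Milgram. -/
theorem exists_sub_apply_eq_of_gap [CompleteSpace H] {T : H →L[ℝ] H} {r : ℝ} (hr : r < 1)
    (hgap : ∀ f, ⟪f, T f⟫_ℝ ≤ r * ‖f‖ ^ 2) (f : H) :
    ∃ g, g - T g = f ∧ (1 - r) * ‖g‖ ≤ ‖f‖ := by
  let B : H →L[ℝ] H →L[ℝ] ℝ := innerSL ℝ ∘L (1 - T)
  have hB (u w : H) : B u w = ⟪u - T u, w⟫_ℝ := rfl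
  have hco (u : H) : (1 - r) * ‖u‖ ^ 2 ≤ ⟪u - T u, u⟫_ℝ := by
    have := hgap u
    rw [inner_sub_left, real_inner_self_eq_norm_sq, real_inner_comm]
    linarith
  have hcoer : IsCoercive B := ⟨1 - r, by linarith, fun u => by
    rw [hB, mul_assoc, ← pow_two]; exact hco u⟩
  obtain ⟨g, hg⟩ := hcoer.continuousLinearEquivOfBilin.surjective f
  have hgf : g - T g = f := by
    rw [← hg]
    refine ext_inner_right ℝ fun w => ?_
    rw [hcoer.continuousLinearEquivOfBilin_apply, hB]
  refine ⟨g, hgf, ?_⟩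
  rcases (norm_nonneg g).eq_or_lt with h0 | hpos
  · simp [← h0]
  · have h1 := (hco g).trans (real_inner_le_norm _ _)
    rw [hgf] at h1
    nlinarith

/-- If the quadratic form of the contraction `T` is bounded away from `1`, then
`n⁻¹ * ⟪f, lagSum T n f⟫` converges to `⟪f, T (1 - T)⁻¹ f⟫`. -/
theorem exists_tendsto_lagSum_of_gap [CompleteSpace H] {T : H →L[ℝ] H} (hT : ‖T‖ ≤ 1) {r : ℝ}
    (hr : r < 1) (hgap : ∀ f, ⟪f, T f⟫_ℝ ≤ r * ‖f‖ ^ 2) (f : H) :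
    ∃ v, Tendsto (fun n : ℕ => (n : ℝ)⁻¹ * ⟪f, lagSum T n f⟫_ℝ) atTop (𝓝 v) ∧
      ‖f‖ ^ 2 + 2 * v ≤ 2 / (1 - r) * ‖f‖ ^ 2 := by
  obtain ⟨g, hg, hgle⟩ := exists_sub_apply_eq_of_gap hr hgap f
  obtain ⟨h, hh, -⟩ := exists_sub_apply_eq_of_gap hr hgap g
  refine ⟨⟪f, T g⟫_ℝ, ?_, ?_⟩
  · have hfh : f = ((1 - T : H →L[ℝ] H) ^ 2) h := by
      rw [pow_two, ← hg, ← hh]; rfl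
    have hlag (n : ℕ) : lagSum T n f = (n : ℝ) • T g - (T h - (T ^ (n + 1)) h) := by
      rw [hfh, ← hh]
      exact congrArg (fun S : H →L[ℝ] H => S h) (lagSum_mul_one_sub_sq T n)
    have herr : Tendsto (fun n : ℕ => (n : ℝ)⁻¹ * ⟪f, T h - (T ^ (n + 1)) h⟫_ℝ) atTop (𝓝 0) := by
      refine tendsto_inv_atTop_nhds_zero_nat.zero_mul_isBoundedUnder_le ?_
      refine isBoundedUnder_of ⟨‖f‖ * (‖h‖ + ‖h‖), fun n => ?_⟩
      refine (norm_inner_le_norm _ _).trans ?_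
      gcongr
      refine (norm_sub_le _ _).trans (add_le_add ?_ (norm_pow_apply_le hT _ _))
      simpa using norm_pow_apply_le hT 1 h
    have hlim := (tendsto_const_nhds (x := ⟪f, T g⟫_ℝ)).sub herr
    rw [sub_zero] at hlim
    refine hlim.congr' ?_
    filter_upwards [eventually_gt_atTop 0] with n hn
    have : (n : ℝ) ≠ 0 := by positivity
    rw [hlag, inner_sub_right f ((n : ℝ) • T g), real_inner_smul_right]
    field_simp
  · have h1 : ‖f‖ ^ 2 + 2 * ⟪f, T g⟫_ℝ = ⟪f, g + T g⟫_ℝ := by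
      rw [← real_inner_self_eq_norm_sq]
      nth_rw 2 [← hg]
      rw [inner_sub_right, inner_add_right]
      ring
    have h2 : ‖T g‖ ≤ ‖g‖ := by simpa using norm_pow_apply_le hT 1 g
    have h3 : ‖g‖ ≤ ‖f‖ / (1 - r) := by
      rw [le_div_iff₀ (by linarith)]; linarith
    rw [h1]
    calc ⟪f, g + T g⟫_ℝ ≤ ‖f‖ * ‖g + T g‖ := real_inner_le_norm _ _
      _ ≤ ‖f‖ * (‖f‖ / (1 - r) + ‖f‖ / (1 - r)) := by
        gcongr
        exact (norm_add_le _ _).trans (by linarith)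
      _ = 2 / (1 - r) * ‖f‖ ^ 2 := by ring

/-- Odd powers inherit an upper bound of the quadratic form, because
`⟪f, T ^ (2 m + 1) f⟫ = ⟪T ^ m f, T (T ^ m f)⟫`. -/
theorem inner_pow_odd_le {T : H →L[ℝ] H} (hT : ‖T‖ ≤ 1)
    (hsymm : ∀ f g, ⟪T f, g⟫_ℝ = ⟪f, T g⟫_ℝ) {r : ℝ} (hr : 0 ≤ r)
    (hgap : ∀ f, ⟪f, T f⟫_ℝ ≤ r * ‖f‖ ^ 2) {k : ℕ} (hk : Odd k) (f : H) :
    ⟪f, (T ^ k) f⟫_ℝ ≤ r * ‖f‖ ^ 2 := by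
  obtain ⟨m, rfl⟩ := hk
  have h : ⟪f, (T ^ (2 * m + 1)) f⟫_ℝ = ⟪(T ^ m) f, T ((T ^ m) f)⟫_ℝ := by
    rw [inner_pow_comm hsymm, two_mul, add_assoc, pow_add_apply, Nat.add_comm m 1, pow_add_apply,
      pow_one]
  rw [h]
  refine (hgap _).trans ?_
  gcongr
  exact norm_pow_apply_le hT m f

/-- A symmetric operator whose correlations `⟪u, T ^ n u⟫` decay at rate `ρ ^ n` satisfies
`‖T u‖ ≤ ρ ‖u‖`: the sequence `‖T ^ n u‖` is log-convex, so its first ratio `‖T u‖ / ‖u‖` is at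
most its exponential rate of decay. -/
theorem norm_apply_le_of_inner_pow_le {T : H →L[ℝ] H}
    (hsymm : ∀ f g, ⟪T f, g⟫_ℝ = ⟪f, T g⟫_ℝ) {ρ : ℝ} (hρ : 0 ≤ ρ) {u : H} {C : ℝ}
    (hC : ∀ n, ⟪u, (T ^ (n + 1)) u⟫_ℝ ≤ C * ρ ^ (n + 1)) : ‖T u‖ ≤ ρ * ‖u‖ := by
  by_contra! hlt
  have hsq (n : ℕ) : ‖(T ^ n) u‖ ^ 2 = ⟪u, (T ^ (2 * n)) u⟫_ℝ := by
    rw [← real_inner_self_eq_norm_sq, inner_pow_comm hsymm, two_mul, pow_add_apply]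
  have hconv (n : ℕ) : ‖(T ^ (n + 1)) u‖ ^ 2 ≤ ‖(T ^ n) u‖ * ‖(T ^ (n + 2)) u‖ := by
    have h : ‖(T ^ (n + 1)) u‖ ^ 2 = ⟪(T ^ n) u, (T ^ (n + 2)) u⟫_ℝ := by
      rw [hsq, inner_pow_comm hsymm, ← pow_add_apply]
      congr 3
      ring
    rw [h]
    exact real_inner_le_norm _ _
  have hu : 0 < ‖u‖ := by
    refine (norm_nonneg u).lt_of_ne fun h0 => ?_
    have : u = 0 := norm_eq_zero.1 h0.symm
    simp [this] at hlt
  have hTu : 0 < ‖T u‖ := lt_of_le_of_lt (by positivity) hlt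
  set q := ‖T u‖ / ‖u‖ with hq
  have hqpos : 0 < q := by positivity
  have hρq : ρ < q := by rw [hq, lt_div_iff₀ hu]; exact hlt
  have hratio (n : ℕ) : 0 < ‖(T ^ n) u‖ ∧ q * ‖(T ^ n) u‖ ≤ ‖(T ^ (n + 1)) u‖ := by
    induction n with
    | zero => simp [hu, hq]; field_simp; simp
    | succ n ih =>
      obtain ⟨ih1, ih2⟩ := ih
      have hpos : 0 < ‖(T ^ (n + 1)) u‖ := lt_of_lt_of_le (by positivity) ih2
      refine ⟨hpos, ?_⟩
      have h1 := hconv n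
      refine le_of_mul_le_mul_left ?_ ih1
      nlinarith
  have hgrow (n : ℕ) : q ^ n * ‖u‖ ≤ ‖(T ^ n) u‖ := by
    induction n with
    | zero => simp
    | succ n ih =>
      refine le_trans ?_ (hratio n).2
      rw [pow_succ']
      nlinarith
  have hbound (n : ℕ) : ((q / ρ) ^ 2) ^ n * ‖u‖ ^ 2 ≤ max C (‖u‖ ^ 2) := by
    rcases n with _ | n
    · simp
    rcases hρ.eq_or_lt with h0 | hρpos
    · simp [← h0]
    refine le_max_of_le_left ?_
    have h1 := hC (2 * n + 1)
    rw [show 2 * n + 1 + 1 = 2 * (n + 1) by ring, ← hsq] at h1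
    have h2 : (q ^ (n + 1) * ‖u‖) ^ 2 ≤ ‖(T ^ (n + 1)) u‖ ^ 2 := by
      gcongr
      exact hgrow _
    have h3 : (q ^ (n + 1) * ‖u‖) ^ 2 / ρ ^ (2 * (n + 1)) ≤ C := by
      rw [div_le_iff₀ (by positivity)]; exact h2.trans h1
    refine le_trans (le_of_eq ?_) h3
    rw [← pow_mul, div_pow, mul_pow, ← pow_mul, mul_comm (n + 1) 2]
    ring
  rcases hρ.eq_or_lt with h0 | hρpos
  · have h1 := hC 1
    have h2 := hsq 1
    norm_num [← h0] at h1 h2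
    rw [← h2] at h1
    nlinarith
  · have hbig : 1 < (q / ρ) ^ 2 := one_lt_pow₀ ((one_lt_div hρpos).2 hρq) two_ne_zero
    obtain ⟨n, hn⟩ := pow_unbounded_of_one_lt (max C (‖u‖ ^ 2) / ‖u‖ ^ 2) hbig
    rw [div_lt_iff₀ (by positivity)] at hn
    exact absurd (hbound n) (not_le.2 hn)

end Hilbert

/-! ### The transition operator on `L²(π)` -/

section Operator

open scoped InnerProductSpace

variable {π : Measure X} [IsProbabilityMeasure π] {Q : Kernel X X} [IsMarkovKernel Q]

theorem measurePreserving_fst_compProd (π : Measure X) [IsProbabilityMeasure π]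
    (Q : Kernel X X) [IsMarkovKernel Q] : MeasurePreserving Prod.fst (π ⊗ₘ Q) π :=
  ⟨measurable_fst, Measure.fst_compProd π Q⟩

theorem measurePreserving_snd_compProd (hQ : Q.Invariant π) :
    MeasurePreserving Prod.snd (π ⊗ₘ Q) π :=
  ⟨measurable_snd, (Measure.snd_compProd π Q).trans hQ⟩

/-- The transition operator `f ↦ ∫ y, f y ∂(Q x)` on `L²(π)`, for `π` invariant under `Q`. It is
built as `A† B`, where `A` and `B` are the isometries `f ↦ f (x)` and `f ↦ f (y)` from `L²(π)`
into `L²` of the law `π ⊗ₘ Q` of two consecutive states `(x, y)`. -/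
noncomputable def kernelOp (hQ : Q.Invariant π) : Lp ℝ 2 π →L[ℝ] Lp ℝ 2 π :=
  ((Lp.compMeasurePreservingₗᵢ ℝ Prod.fst
      (measurePreserving_fst_compProd π Q)).toContinuousLinearMap).adjoint ∘L
    (Lp.compMeasurePreservingₗᵢ ℝ Prod.snd
      (measurePreserving_snd_compProd hQ)).toContinuousLinearMap

theorem inner_kernelOp_eq_inner (hQ : Q.Invariant π) (f g : Lp ℝ 2 π) :
    ⟪f, kernelOp hQ g⟫_ℝ =
      ⟪Lp.compMeasurePreserving Prod.fst (measurePreserving_fst_compProd π Q) f,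
        Lp.compMeasurePreserving Prod.snd (measurePreserving_snd_compProd hQ) g⟫_ℝ := by
  rw [kernelOp, ContinuousLinearMap.comp_apply, ContinuousLinearMap.adjoint_inner_right]
  rfl

theorem norm_kernelOp_apply_le (hQ : Q.Invariant π) (f : Lp ℝ 2 π) : ‖kernelOp hQ f‖ ≤ ‖f‖ := by
  rcases (norm_nonneg (kernelOp hQ f)).eq_or_lt with h0 | hpos
  · rw [← h0]; exact norm_nonneg f
  have h := real_inner_self_eq_norm_sq (kernelOp hQ f)
  rw [inner_kernelOp_eq_inner] at h
  have h1 := real_inner_le_norm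
    (Lp.compMeasurePreserving Prod.fst (measurePreserving_fst_compProd π Q) (kernelOp hQ f))
    (Lp.compMeasurePreserving Prod.snd (measurePreserving_snd_compProd hQ) f)
  rw [h, Lp.norm_compMeasurePreserving, Lp.norm_compMeasurePreserving] at h1
  nlinarith

theorem inner_kernelOp (hQ : Q.Invariant π) (f g : Lp ℝ 2 π) :
    ⟪f, kernelOp hQ g⟫_ℝ = ∫ p, f p.1 * g p.2 ∂(π ⊗ₘ Q) := by
  rw [inner_kernelOp_eq_inner, L2.inner_def]
  refine integral_congr_ae ?_
  filter_upwards [Lp.coeFn_compMeasurePreserving f (measurePreserving_fst_compProd π Q),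
    Lp.coeFn_compMeasurePreserving g (measurePreserving_snd_compProd hQ)] with p h1 h2
  rw [h1, h2, RCLike.inner_apply, conj_trivial, mul_comm]
  rfl

/-- The operator is symmetric for a reversible kernel, as then `π ⊗ₘ Q` is exchangeable. -/
theorem inner_kernelOp_comm (hrev : Q.IsReversible π) (f g : Lp ℝ 2 π) :
    ⟪kernelOp hrev.invariant f, g⟫_ℝ = ⟪f, kernelOp hrev.invariant g⟫_ℝ := by
  have hswap : (π ⊗ₘ Q).map Prod.swap = π ⊗ₘ Q := by
    refine Measure.ext_prod fun {s t} hs ht => ?_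
    rw [Measure.map_apply measurable_swap (hs.prod ht), Set.preimage_swap_prod,
      Measure.compProd_apply_prod ht hs, Measure.compProd_apply_prod hs ht]
    exact hrev ht hs
  have hmp : MeasurePreserving MeasurableEquiv.prodComm (π ⊗ₘ Q) (π ⊗ₘ Q) :=
    ⟨measurable_swap, hswap⟩
  rw [real_inner_comm, inner_kernelOp, inner_kernelOp, ← hmp.integral_comp']
  refine integral_congr_ae (Eventually.of_forall fun p => ?_)
  exact mul_comm _ _

theorem kernelOp_ae_eq (hQ : Q.Invariant π) (f : Lp ℝ 2 π) :
    kernelOp hQ f =ᵐ[π] fun x => ∫ y, f y ∂(Q x) := by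
  have hf : Integrable (fun p : X × X => f p.2) (π ⊗ₘ Q) :=
    (measurePreserving_snd_compProd hQ).integrable_comp_of_integrable
      ((Lp.memLp f).integrable one_le_two)
  have hint : Integrable (fun x => ∫ y, f y ∂(Q x)) π := by
    simpa using Integrable.integral_compProd (κ := Kernel.const Unit π)
      (η := Kernel.prodMkLeft Unit Q) (a := ()) hf
  refine Integrable.ae_eq_of_forall_setIntegral_eq _ _
    ((Lp.memLp _).integrable one_le_two) hint fun s hs _ => ?_
  rw [← L2.inner_indicatorConstLp_one hs (measure_ne_top π s), inner_kernelOp]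
  have h1 := Measure.setIntegral_compProd hs MeasurableSet.univ hf.integrableOn
  simp only [Measure.restrict_univ] at h1
  rw [← h1, ← integral_indicator (hs.prod MeasurableSet.univ)]
  refine integral_congr_ae ?_
  filter_upwards [(measurePreserving_fst_compProd π Q).quasiMeasurePreserving.ae_eq_comp
    (indicatorConstLp_coeFn (p := 2) (hs := hs) (hμs := measure_ne_top π s) (c := (1 : ℝ)))]
    with p hp
  simp only [Function.comp_apply] at hp
  rw [hp]
  by_cases hps : p.1 ∈ s <;> simp [hps]

theorem kernelOp_comp {R : Kernel X X} [IsMarkovKernel R] (hR : R.Invariant π)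
    (hQ : Q.Invariant π) (hRQ : (R ∘ₖ Q).Invariant π) :
    kernelOp hRQ = kernelOp hQ ∘L kernelOp hR := by
  ext1 f
  refine Lp.ext ?_
  have hint : ∀ᵐ x ∂π, Integrable f ((R ∘ₖ Q) x) := by
    refine Measure.ae_integrable_of_integrable_comp ?_
    have : (R ∘ₖ Q) ∘ₘ π = π := hRQ
    rw [this]
    exact (Lp.memLp f).integrable one_le_two
  have hae : ∀ᵐ x ∂π, ∀ᵐ y ∂(Q x), kernelOp hR f y = ∫ z, f z ∂(R y) := by
    refine Measure.ae_ae_of_ae_comp ?_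
    have : Q ∘ₘ π = π := hQ
    rw [this]
    exact kernelOp_ae_eq hR f
  filter_upwards [kernelOp_ae_eq hRQ f, kernelOp_ae_eq hQ (kernelOp hR f), hint, hae]
    with x h1 h2 h3 h4
  rw [h1, ContinuousLinearMap.comp_apply, h2, Kernel.integral_comp h3]
  exact (integral_congr_ae h4).symm

/-- The constant function `1` as an element of `L²(π)`. -/
noncomputable def oneL2 (π : Measure X) [IsProbabilityMeasure π] : Lp ℝ 2 π :=
  Lp.const 2 π (1 : ℝ)

theorem inner_oneL2 (f : Lp ℝ 2 π) : ⟪oneL2 π, f⟫_ℝ = ∫ x, f x ∂π := by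
  have := L2.inner_indicatorConstLp_one (𝕜 := ℝ) MeasurableSet.univ (measure_ne_top π _) f
  rwa [indicatorConstLp_univ, Measure.restrict_univ] at this

theorem norm_oneL2 : ‖oneL2 π‖ = 1 := by
  simp [oneL2, Lp.norm_const]

theorem inner_oneL2_kernelOp (hQ : Q.Invariant π) (f : Lp ℝ 2 π) :
    ⟪oneL2 π, kernelOp hQ f⟫_ℝ = ⟪oneL2 π, f⟫_ℝ := by
  have hmp := measurePreserving_snd_compProd hQ
  have hf : Integrable (fun p : X × X => f p.2) (π ⊗ₘ Q) :=
    hmp.integrable_comp_of_integrable ((Lp.memLp f).integrable one_le_two)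
  rw [inner_oneL2, inner_oneL2, integral_congr_ae (kernelOp_ae_eq hQ f),
    ← Measure.integral_compProd hf]
  have h := integral_map (f := f) hmp.aemeasurable
    (by rw [hmp.map_eq]; exact Lp.aestronglyMeasurable f)
  rw [← h, hmp.map_eq]

theorem kernelOp_oneL2 (hQ : Q.Invariant π) : kernelOp hQ (oneL2 π) = oneL2 π := by
  have h1 : ⟪oneL2 π, kernelOp hQ (oneL2 π)⟫_ℝ = 1 := by
    rw [inner_oneL2_kernelOp, real_inner_self_eq_norm_sq, norm_oneL2, one_pow]
  have h2 := norm_kernelOp_apply_le hQ (oneL2 π)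
  rw [norm_oneL2] at h2
  have h3 := norm_sub_sq_real (oneL2 π) (kernelOp hQ (oneL2 π))
  rw [h1, norm_oneL2] at h3
  have h4 : ‖kernelOp hQ (oneL2 π)‖ ^ 2 ≤ 1 := pow_le_one₀ (norm_nonneg _) h2
  have h5 : ‖oneL2 π - kernelOp hQ (oneL2 π)‖ ^ 2 ≤ 0 := by linarith
  have h6 : ‖oneL2 π - kernelOp hQ (oneL2 π)‖ = 0 :=
    pow_eq_zero_iff two_ne_zero |>.1 (le_antisymm h5 (sq_nonneg _))
  exact (sub_eq_zero.1 (norm_eq_zero.1 h6)).symm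

/-- The orthogonal projection `f ↦ π(f)` of `L²(π)` onto the constants. -/
noncomputable def meanOp (π : Measure X) [IsProbabilityMeasure π] : Lp ℝ 2 π →L[ℝ] Lp ℝ 2 π :=
  (innerSL ℝ (oneL2 π)).smulRight (oneL2 π)

theorem meanOp_apply (f : Lp ℝ 2 π) : meanOp π f = ⟪oneL2 π, f⟫_ℝ • oneL2 π := rfl

/-- The transition operator with the constants split off, `f ↦ Q f - π(f)`. It vanishes on
constants and agrees with `Q` on functions of mean zero, so that a spectral gap of `Q` on the
latter is a bound on this operator on the whole of `L²(π)`. -/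
noncomputable def centeredOp (hQ : Q.Invariant π) : Lp ℝ 2 π →L[ℝ] Lp ℝ 2 π :=
  kernelOp hQ - meanOp π

theorem centeredOp_apply (hQ : Q.Invariant π) (f : Lp ℝ 2 π) :
    centeredOp hQ f = kernelOp hQ f - ⟪oneL2 π, f⟫_ℝ • oneL2 π := rfl

theorem inner_centeredOp (hQ : Q.Invariant π) (f g : Lp ℝ 2 π) :
    ⟪f, centeredOp hQ g⟫_ℝ =
      ⟪f, kernelOp hQ g⟫_ℝ - ⟪oneL2 π, f⟫_ℝ * ⟪oneL2 π, g⟫_ℝ := by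
  rw [centeredOp_apply, inner_sub_right, real_inner_smul_right, real_inner_comm, mul_comm,
    real_inner_comm (oneL2 π) f]

theorem norm_centeredOp_le (hQ : Q.Invariant π) : ‖centeredOp hQ‖ ≤ 1 := by
  refine ContinuousLinearMap.opNorm_le_bound _ zero_le_one fun f => ?_
  have h1 : ‖centeredOp hQ f‖ ^ 2 = ‖kernelOp hQ f‖ ^ 2 - ⟪oneL2 π, f⟫_ℝ ^ 2 := by
    rw [centeredOp_apply, norm_sub_sq_real, real_inner_smul_right, real_inner_comm (oneL2 π),
      inner_oneL2_kernelOp, norm_smul, norm_oneL2, mul_one, Real.norm_eq_abs, sq_abs]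
    ring
  have h2 : ‖kernelOp hQ f‖ ^ 2 ≤ ‖f‖ ^ 2 := by
    gcongr; exact norm_kernelOp_apply_le hQ f
  rw [one_mul]
  refine abs_le_of_sq_le_sq' ?_ (norm_nonneg f) |>.2
  nlinarith [sq_nonneg ⟪oneL2 π, f⟫_ℝ]

theorem inner_centeredOp_comm (hrev : Q.IsReversible π) (f g : Lp ℝ 2 π) :
    ⟪centeredOp hrev.invariant f, g⟫_ℝ = ⟪f, centeredOp hrev.invariant g⟫_ℝ := by
  rw [real_inner_comm, inner_centeredOp, inner_centeredOp, ← inner_kernelOp_comm hrev,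
    real_inner_comm (kernelOp _ _), mul_comm]

theorem centeredOp_comp {R : Kernel X X} [IsMarkovKernel R] (hR : R.Invariant π)
    (hQ : Q.Invariant π) (hRQ : (R ∘ₖ Q).Invariant π) :
    centeredOp hRQ = centeredOp hQ * centeredOp hR := by
  ext1 f
  change _ = centeredOp hQ (centeredOp hR f)
  have h : ⟪oneL2 π, centeredOp hR f⟫_ℝ = 0 := by
    rw [inner_centeredOp, inner_oneL2_kernelOp, real_inner_self_eq_norm_sq, norm_oneL2]
    ring
  rw [centeredOp_apply hQ, h, zero_smul, sub_zero, centeredOp_apply hR, map_sub, map_smul,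
    kernelOp_oneL2, centeredOp_apply, kernelOp_comp hR hQ hRQ]
  rfl

theorem invariant_pow {ν : Measure X} {R : Kernel X X} (hR : R.Invariant ν) (k : ℕ) :
    (R ^ k).Invariant ν := by
  induction k with
  | zero =>
    rw [pow_zero]
    exact Measure.id_comp
  | succ k ih => rw [pow_succ]; exact ih.comp hR

instance (k : ℕ) : IsMarkovKernel (Q ^ k) := isMarkovKernel_pow Q k

theorem kernelOp_congr {R : Kernel X X} [IsMarkovKernel R] (hR : R.Invariant π)
    (hQ : Q.Invariant π) (h : R = Q) : kernelOp hR = kernelOp hQ := by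
  subst h; rfl

theorem centeredOp_pow (hQ : Q.Invariant π) (k : ℕ) :
    centeredOp (invariant_pow hQ (k + 1)) = centeredOp hQ ^ (k + 1) := by
  induction k with
  | zero =>
    rw [zero_add, pow_one (centeredOp hQ), centeredOp, centeredOp, kernelOp_congr _ hQ (pow_one Q)]
  | succ k ih =>
    rw [pow_succ' (centeredOp hQ), ← ih, ← centeredOp_comp (invariant_pow hQ (k + 1)) hQ
      ((invariant_pow hQ (k + 1)).comp hQ), centeredOp, centeredOp,
      kernelOp_congr _ ((invariant_pow hQ (k + 1)).comp hQ) (pow_succ Q (k + 1))]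

end Operator

/-! ### Covariances of the stationary chain and the spectral gap -/

section Chain

open scoped InnerProductSpace

variable {π : Measure X} [IsProbabilityMeasure π] {Q : Kernel X X} [IsMarkovKernel Q]

instance : IsProbabilityMeasure (chainLaw Q π) := by
  rw [chainLaw]; infer_instance

theorem lintegral_chainLaw_succ (a : ℕ) {F : ((i : Finset.Iic a) → X) → ℝ≥0∞} (hF : Measurable F)
    {g : X → ℝ≥0∞} (hg : Measurable g) :
    ∫⁻ ω, F (Preorder.frestrictLe a ω) * g (ω (a + 1)) ∂(chainLaw Q π) =
      ∫⁻ ω, F (Preorder.frestrictLe a ω) * ∫⁻ y, g y ∂(Q (ω a)) ∂(chainLaw Q π) := by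
  have h := Kernel.map_frestrictLe_trajMeasure_compProd_eq_map_trajMeasure
    (X := fun _ : ℕ => X) (μ₀ := π) (κ := fun n : ℕ =>
      Q.comap (fun ω : (i : Finset.Iic n) → X => ω ⟨n, Finset.mem_Iic.2 le_rfl⟩)
        (measurable_pi_apply _)) (a := a)
  have hm : Measurable fun p : ((i : Finset.Iic a) → X) × X => F p.1 * g p.2 := by fun_prop
  have h1 := lintegral_map (μ := chainLaw Q π) hm
    (g := fun ω => (Preorder.frestrictLe a ω, ω (a + 1))) (by fun_prop)
  change (chainLaw Q π).map _ ⊗ₘ _ = (chainLaw Q π).map _ at h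
  rw [← h1, ← h, Measure.lintegral_compProd hm, lintegral_map ?_ (by fun_prop)]
  · refine lintegral_congr fun ω => ?_
    change ∫⁻ y, F (Preorder.frestrictLe a ω) * g y ∂(Q (ω a)) = _
    rw [lintegral_const_mul _ hg]
  · exact hm.lintegral_kernel_prod_right'

theorem map_eval_chainLaw (hQ : Q.Invariant π) (i : ℕ) :
    (chainLaw Q π).map (fun ω => ω i) = π := by
  induction i with
  | zero =>
    have h := Kernel.traj_map_frestrictLe (X := fun _ : ℕ => X) (κ := fun n : ℕ =>
      Q.comap (fun ω : (i : Finset.Iic n) → X => ω ⟨n, Finset.mem_Iic.2 le_rfl⟩)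
        (measurable_pi_apply _)) 0 0
    have he : (fun ω : ℕ → X => ω 0) =
        (fun ω : (i : Finset.Iic 0) → X => ω ⟨0, Finset.mem_Iic.2 le_rfl⟩) ∘
          (Preorder.frestrictLe (π := fun _ : ℕ => X) 0) := rfl
    rw [he, ← Measure.map_map (measurable_pi_apply _) (by fun_prop), chainLaw,
      Kernel.trajMeasure, Measure.map_comp _ _ (by fun_prop), h, Kernel.partialTraj_self,
      Measure.id_comp, Measure.map_map (measurable_pi_apply _) (MeasurableEquiv.measurable _)]
    exact Measure.map_id
  | succ i ih =>
    ext s hs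
    have h := lintegral_chainLaw_succ (π := π) (Q := Q) i (F := fun _ => 1) measurable_const
      (g := s.indicator 1) (measurable_one.indicator hs)
    simp only [one_mul, lintegral_indicator_one hs] at h
    have h2 : ∫⁻ ω, Q (ω i) s ∂(chainLaw Q π) = π s := by
      rw [← lintegral_map (f := fun x => Q x s) (g := fun ω : ℕ → X => ω i)
        (Q.measurable_coe hs) (measurable_pi_apply i), ih,
        ← Measure.bind_apply hs Q.measurable.aemeasurable]
      exact congrArg (fun ν : Measure X => ν s) hQ
    rw [← h2, ← h, ← lintegral_indicator_one hs,
      lintegral_map (measurable_one.indicator hs) (measurable_pi_apply _)]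

/-- Under the stationary chain law, the states at times `i` and `i + k` have the joint law of a
`k`-step transition from `π`. -/
theorem map_pair_chainLaw (hQ : Q.Invariant π) (i k : ℕ) :
    (chainLaw Q π).map (fun ω => (ω i, ω (i + k))) = π ⊗ₘ (Q ^ k) := by
  have key (s : Set X) (hs : MeasurableSet s) (g : X → ℝ≥0∞) (hg : Measurable g) :
      ∫⁻ ω, s.indicator 1 (ω i) * g (ω (i + k)) ∂(chainLaw Q π) =
        ∫⁻ ω, s.indicator 1 (ω i) * ∫⁻ y, g y ∂((Q ^ k) (ω i)) ∂(chainLaw Q π) := by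
    induction k generalizing g with
    | zero =>
      refine lintegral_congr fun ω => ?_
      rw [pow_zero, show (1 : Kernel X X) = Kernel.id from rfl, Kernel.id_apply,
        lintegral_dirac' _ hg, add_zero]
    | succ k ih =>
      have h := lintegral_chainLaw_succ (π := π) (Q := Q) (i + k)
        (F := fun ω => s.indicator 1 (ω ⟨i, Finset.mem_Iic.2 (Nat.le_add_right i k)⟩))
        ((measurable_one.indicator hs).comp (measurable_pi_apply _)) hg
      refine h.trans ((ih _ hg.lintegral_kernel).trans (lintegral_congr fun ω => ?_))
      rw [pow_succ', show Q * Q ^ k = Q ∘ₖ (Q ^ k) from rfl, Kernel.lintegral_comp _ _ _ hg]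
  refine Measure.ext_prod fun {s t} hs ht => ?_
  have h := key s hs (t.indicator 1) (measurable_one.indicator ht)
  simp only [lintegral_indicator_one ht] at h
  rw [Measure.compProd_apply_prod hs ht, ← lintegral_indicator_one (hs.prod ht),
    lintegral_map (measurable_one.indicator (hs.prod ht)) (by fun_prop)]
  have e1 (ω : ℕ → X) : (s ×ˢ t).indicator (1 : X × X → ℝ≥0∞) (ω i, ω (i + k)) =
      s.indicator 1 (ω i) * t.indicator 1 (ω (i + k)) := by
    by_cases h1 : ω i ∈ s <;> by_cases h2 : ω (i + k) ∈ t <;> simp [h1, h2]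
  simp only [e1]
  rw [h, ← lintegral_map (f := fun x => s.indicator 1 x * (Q ^ k) x t)
      (g := fun ω : ℕ → X => ω i)
      ((measurable_one.indicator hs).mul ((Q ^ k).measurable_coe ht)) (measurable_pi_apply i),
    map_eval_chainLaw hQ, ← lintegral_indicator hs]
  refine lintegral_congr fun x => ?_
  by_cases hx : x ∈ s <;> simp [hx]

theorem memLp_eval_chainLaw (hQ : Q.Invariant π) {f : X → ℝ} (hf : MemLp f 2 π) (i : ℕ) :
    MemLp (fun ω : ℕ → X => f (ω i)) 2 (chainLaw Q π) :=
  hf.comp_measurePreserving ⟨measurable_pi_apply i, map_eval_chainLaw hQ i⟩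

theorem integral_eval_chainLaw (hQ : Q.Invariant π) {f : X → ℝ} (hf : MemLp f 2 π) (i : ℕ) :
    ∫ ω, f (ω i) ∂(chainLaw Q π) = ∫ x, f x ∂π := by
  rw [← integral_map (φ := fun ω : ℕ → X => ω i) (measurable_pi_apply i).aemeasurable
    (by rw [map_eval_chainLaw hQ]; exact hf.1), map_eval_chainLaw hQ]

theorem integral_eq_inner_oneL2 {f : X → ℝ} (hf : MemLp f 2 π) :
    ∫ x, f x ∂π = ⟪oneL2 π, hf.toLp f⟫_ℝ := by
  rw [inner_oneL2, integral_congr_ae hf.coeFn_toLp]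

/-- The covariance of `f` at two different times of the stationary chain. -/
theorem covariance_chainLaw (hQ : Q.Invariant π) {f : X → ℝ} (hf : MemLp f 2 π) (i k : ℕ) :
    cov[fun ω => f (ω (i + (k + 1))), fun ω => f (ω i); chainLaw Q π] =
      ⟪hf.toLp f, (centeredOp hQ ^ (k + 1)) (hf.toLp f)⟫_ℝ := by
  rw [← centeredOp_pow, inner_centeredOp, inner_kernelOp, covariance_comm,
    covariance_eq_sub (memLp_eval_chainLaw hQ hf _) (memLp_eval_chainLaw hQ hf _),
    integral_eval_chainLaw hQ hf, integral_eval_chainLaw hQ hf, integral_eq_inner_oneL2 hf]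
  congr 1
  have h1 := (measurePreserving_fst_compProd π (Q ^ (k + 1))).quasiMeasurePreserving.ae_eq_comp
    hf.coeFn_toLp
  have h2 := (measurePreserving_snd_compProd
    (invariant_pow hQ (k + 1))).quasiMeasurePreserving.ae_eq_comp hf.coeFn_toLp
  have hae : (fun p : X × X => hf.toLp f p.1 * hf.toLp f p.2) =ᵐ[π ⊗ₘ (Q ^ (k + 1))]
      fun p => f p.1 * f p.2 := by
    filter_upwards [h1, h2] with p hp1 hp2
    simp only [Function.comp_apply] at hp1 hp2
    rw [hp1, hp2]
  have hsm : AEStronglyMeasurable (fun p : X × X => f p.1 * f p.2) (π ⊗ₘ (Q ^ (k + 1))) :=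
    (hf.1.comp_measurePreserving (measurePreserving_fst_compProd π _)).mul
      (hf.1.comp_measurePreserving (measurePreserving_snd_compProd (invariant_pow hQ (k + 1))))
  rw [integral_congr_ae hae, ← map_pair_chainLaw hQ i, integral_map]
  · rfl
  · fun_prop
  · rwa [map_pair_chainLaw hQ]

theorem variance_eval_chainLaw (hQ : Q.Invariant π) {f : X → ℝ} (hf : MemLp f 2 π) (i : ℕ) :
    variance (fun ω => f (ω i)) (chainLaw Q π) = variance f π := by
  have hf2 : MemLp (fun x => f x ^ 2) 1 π := memLp_one_iff_integrable.2 hf.integrable_sq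
  rw [variance_eq_sub (memLp_eval_chainLaw hQ hf i), variance_eq_sub hf,
    integral_eval_chainLaw hQ hf]
  congr 1
  have h := integral_map (φ := fun ω : ℕ → X => ω i) (μ := chainLaw Q π) (f := fun x => f x ^ 2)
    (measurable_pi_apply i).aemeasurable (by rw [map_eval_chainLaw hQ]; exact hf2.1)
  rw [map_eval_chainLaw hQ] at h
  exact h.symm

theorem sum_sum_range_eq_of_symm (c : ℕ → ℕ → ℝ) (hc : ∀ i j, c i j = c j i) (n : ℕ) :
    ∑ i ∈ Finset.range n, ∑ j ∈ Finset.range n, c i j =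
      ∑ i ∈ Finset.range n, c i i + 2 * ∑ i ∈ Finset.range n, ∑ j ∈ Finset.range i, c i j := by
  induction n with
  | zero => simp
  | succ n ih =>
    simp only [Finset.sum_range_succ _ n, Finset.sum_add_distrib, ih]
    rw [Finset.sum_congr rfl fun i _ => hc i n]
    ring

theorem variance_ergodicAverage (hQ : Q.Invariant π) {f : X → ℝ} (hf : MemLp f 2 π) {n : ℕ}
    (hn : 0 < n) :
    (n : ℝ) * variance (ergodicAverage f n) (chainLaw Q π) =
      variance f π +
        2 * ((n : ℝ)⁻¹ * ⟪hf.toLp f, lagSum (centeredOp hQ) n (hf.toLp f)⟫_ℝ) := by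
  have hn' : (n : ℝ) ≠ 0 := by positivity
  have hav : ergodicAverage f n = fun ω : ℕ → X =>
      (1 / (n : ℝ)) * (∑ i ∈ Finset.range n, f (ω i)) := rfl
  have hdiag (i : ℕ) : cov[fun ω => f (ω i), fun ω => f (ω i); chainLaw Q π] = variance f π := by
    rw [covariance_self (memLp_eval_chainLaw hQ hf i).1.aemeasurable,
      variance_eval_chainLaw hQ hf]
  have hoff (i : ℕ) : ∑ j ∈ Finset.range i, cov[fun ω => f (ω i), fun ω => f (ω j); chainLaw Q π] =
      ∑ j ∈ Finset.range i, ⟪hf.toLp f, (centeredOp hQ ^ (j + 1)) (hf.toLp f)⟫_ℝ := by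
    rw [← Finset.sum_range_reflect]
    refine Finset.sum_congr rfl fun j hj => ?_
    rw [← covariance_chainLaw hQ hf (i - 1 - j) j]
    have : i - 1 - j + (j + 1) = i := by
      have := Finset.mem_range.1 hj
      lia
    rw [this]
  rw [hav, variance_const_mul, variance_fun_sum' fun i _ => memLp_eval_chainLaw hQ hf i,
    sum_sum_range_eq_of_symm _ fun i j => covariance_comm _ _, inner_lagSum]
  simp only [hdiag, hoff, Finset.sum_const, Finset.card_range, nsmul_eq_mul]
  field_simp

theorem variance_eq_norm_sub {f : X → ℝ} (hf : MemLp f 2 π) :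
    variance f π = ‖hf.toLp f - meanOp π (hf.toLp f)‖ ^ 2 := by
  have h : ∫ x, f x ^ 2 ∂π = ‖hf.toLp f‖ ^ 2 := by
    rw [← real_inner_self_eq_norm_sq, L2.inner_def]
    refine integral_congr_ae ?_
    filter_upwards [hf.coeFn_toLp] with x hx
    simp [hx, pow_two]
  rw [variance_eq_sub hf, integral_eq_inner_oneL2 hf, meanOp_apply, norm_sub_sq_real,
    real_inner_smul_right, real_inner_comm (oneL2 π), norm_smul, norm_oneL2, mul_one,
    Real.norm_eq_abs, sq_abs, ← h]
  change ∫ x, f x ^ 2 ∂π - _ = _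
  ring

/-- A variance bounding reversible kernel has a right spectral gap. Only the existence and
finiteness of the asymptotic variances enter: the bound follows by uniform boundedness. -/
theorem VarianceBounding.exists_gap (hrev : Q.IsReversible π) (hvb : VarianceBounding Q π) :
    ∃ r < 1, ∀ f, ⟪f, centeredOp hrev.invariant f⟫_ℝ ≤ r * ‖f‖ ^ 2 := by
  refine exists_gap_of_tendsto_lagSum (norm_centeredOp_le _) (inner_centeredOp_comm hrev)
    fun f => ?_
  obtain ⟨K, hK⟩ := hvb
  obtain ⟨v, hv, -⟩ := hK f (Lp.memLp f)
  refine ⟨(v - variance f π) / 2, ((hv.sub_const (variance f π)).div_const 2).congr' ?_⟩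
  filter_upwards [eventually_gt_atTop 0] with n hn
  rw [variance_ergodicAverage hrev.invariant (Lp.memLp f) hn, Lp.toLp_coeFn]
  ring

/-- The correlations see only the part of `f` orthogonal to the constants. -/
theorem inner_lagSum_centeredOp_sub_meanOp (hQ : Q.Invariant π) (n : ℕ) (f : Lp ℝ 2 π) :
    ⟪f - meanOp π f, lagSum (centeredOp hQ) n (f - meanOp π f)⟫_ℝ =
      ⟪f, lagSum (centeredOp hQ) n f⟫_ℝ := by
  have hone : centeredOp hQ (oneL2 π) = 0 := by
    rw [centeredOp_apply, kernelOp_oneL2, real_inner_self_eq_norm_sq, norm_oneL2, one_pow,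
      one_smul, sub_self]
  have horth (g : Lp ℝ 2 π) : ⟪oneL2 π, centeredOp hQ g⟫_ℝ = 0 := by
    rw [inner_centeredOp, inner_oneL2_kernelOp, real_inner_self_eq_norm_sq, norm_oneL2]
    ring
  simp only [inner_lagSum]
  refine Finset.sum_congr rfl fun i _ => Finset.sum_congr rfl fun j _ => ?_
  have h1 : (centeredOp hQ ^ (j + 1)) (f - meanOp π f) = (centeredOp hQ ^ (j + 1)) f := by
    rw [pow_add_apply, pow_add_apply, pow_one, map_sub, meanOp_apply, map_smul, hone, smul_zero,
      sub_zero]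
  rw [h1, Nat.add_comm j 1, pow_add_apply, pow_one, inner_sub_left, meanOp_apply,
    real_inner_smul_left, horth, mul_zero, sub_zero]

/-- Conversely, a right spectral gap of a kernel with invariant law `π` makes it variance
bounding; no reversibility is needed. -/
theorem varianceBounding_of_gap (hQ : Q.Invariant π) {r : ℝ} (hr : r < 1)
    (hgap : ∀ f, ⟪f, centeredOp hQ f⟫_ℝ ≤ r * ‖f‖ ^ 2) : VarianceBounding Q π := by
  refine ⟨2 / (1 - r), fun f hf => ?_⟩
  obtain ⟨v, hv, hle⟩ := exists_tendsto_lagSum_of_gap (norm_centeredOp_le hQ) hr hgap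
    (hf.toLp f - meanOp π (hf.toLp f))
  rw [← variance_eq_norm_sub hf] at hle
  refine ⟨variance f π + 2 * v, ((hv.const_mul 2).const_add (variance f π)).congr' ?_, hle⟩
  filter_upwards [eventually_gt_atTop 0] with n hn
  rw [variance_ergodicAverage hQ hf hn, inner_lagSum_centeredOp_sub_meanOp]

end Chain

/-! ### Time sampling and Dirichlet forms -/

section TimeSampling

open scoped InnerProductSpace

variable {π : Measure X} [IsProbabilityMeasure π] {Q : Kernel X X} [IsMarkovKernel Q]

/-- The Dirichlet form of an invariant kernel. -/
theorem norm_sq_sub_inner_kernelOp (hQ : Q.Invariant π) (f : Lp ℝ 2 π) :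
    2 * (‖f‖ ^ 2 - ⟪f, kernelOp hQ f⟫_ℝ) = ∫ p, (f p.1 - f p.2) ^ 2 ∂(π ⊗ₘ Q) := by
  have h1 := norm_sub_sq_real
    (Lp.compMeasurePreserving Prod.fst (measurePreserving_fst_compProd π Q) f)
    (Lp.compMeasurePreserving Prod.snd (measurePreserving_snd_compProd hQ) f)
  rw [← inner_kernelOp_eq_inner hQ, Lp.norm_compMeasurePreserving, Lp.norm_compMeasurePreserving,
    ← real_inner_self_eq_norm_sq, L2.inner_def] at h1
  have h2 : ∫ p, (f p.1 - f p.2) ^ 2 ∂(π ⊗ₘ Q) =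
      ‖f‖ ^ 2 - 2 * ⟪f, kernelOp hQ f⟫_ℝ + ‖f‖ ^ 2 := by
    rw [← h1]
    refine integral_congr_ae ?_
    filter_upwards [Lp.coeFn_compMeasurePreserving f (measurePreserving_fst_compProd π Q),
      Lp.coeFn_compMeasurePreserving f (measurePreserving_snd_compProd hQ),
      Lp.coeFn_sub (Lp.compMeasurePreserving Prod.fst (measurePreserving_fst_compProd π Q) f)
        (Lp.compMeasurePreserving Prod.snd (measurePreserving_snd_compProd hQ) f)]
      with p hp1 hp2 hp3
    rw [hp3, Pi.sub_apply, hp1, hp2, real_inner_self_eq_norm_sq, Real.norm_eq_abs, sq_abs]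
    rfl
  rw [h2]
  ring

/-- Dirichlet forms are monotone in the law of a transition: if `Q` makes the transitions of `R`
with weight at least `c`, its centred quadratic form is at most that of the mixture
`(1 - c) + c R`. -/
theorem inner_centeredOp_le_of_smul_compProd_le {R : Kernel X X} [IsMarkovKernel R]
    (hR : R.Invariant π) (hQ : Q.Invariant π) {c : ℝ≥0∞} (hc : c ≤ 1)
    (hle : c • (π ⊗ₘ R) ≤ π ⊗ₘ Q) (f : Lp ℝ 2 π) :
    ⟪f, centeredOp hQ f⟫_ℝ ≤
      (1 - c.toReal) * ‖f‖ ^ 2 + c.toReal * ⟪f, centeredOp hR f⟫_ℝ := by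
  have hint : Integrable (fun p : X × X => (f p.1 - f p.2) ^ 2) (π ⊗ₘ Q) :=
    (((Lp.memLp f).comp_measurePreserving (measurePreserving_fst_compProd π Q)).sub
      ((Lp.memLp f).comp_measurePreserving (measurePreserving_snd_compProd hQ))).integrable_sq
  have h := integral_mono_measure hle (Eventually.of_forall fun p => sq_nonneg _) hint
  rw [integral_smul_measure, ← norm_sq_sub_inner_kernelOp hQ, ← norm_sq_sub_inner_kernelOp hR,
    smul_eq_mul] at h
  have hc' : c.toReal ≤ 1 := by
    simpa using ENNReal.toReal_mono ENNReal.one_ne_top hc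
  rw [inner_centeredOp, inner_centeredOp]
  nlinarith [mul_self_nonneg ⟪oneL2 π, f⟫_ℝ]

theorem timeSampled_apply (P : Kernel X X) (μ : Measure ℕ) (x : X) {s : Set X}
    (hs : MeasurableSet s) : timeSampled P μ x s = ∑' k, μ {k} * (P ^ k) x s := by
  change (Measure.sum fun k : ℕ => μ {k} • (P ^ k) x) s = _
  simp [Measure.sum_apply _ hs]

theorem invariant_timeSampled {ν : Measure X} {R : Kernel X X} (hR : R.Invariant ν) (μ : Measure ℕ)
    [IsProbabilityMeasure μ] :
    (timeSampled R μ).Invariant ν := by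
  refine Measure.ext fun s hs => ?_
  have hk (k : ℕ) : ∫⁻ x, (R ^ k) x s ∂ν = ν s := by
    rw [← Measure.bind_apply hs (R ^ k).measurable.aemeasurable]
    exact congrArg (fun m : Measure X => m s) (invariant_pow hR k)
  have hμ : ∑' k, μ {k} = 1 := by
    simpa using μ.tsum_indicator_apply_singleton Set.univ MeasurableSet.univ
  rw [Measure.bind_apply hs (timeSampled R μ).measurable.aemeasurable]
  simp only [timeSampled_apply R μ _ hs]
  rw [lintegral_tsum fun k => (((R ^ k).measurable_coe hs).const_mul _).aemeasurable]
  simp only [lintegral_const_mul _ ((R ^ _).measurable_coe hs), hk]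
  rw [ENNReal.tsum_mul_right, hμ, one_mul]

theorem smul_compProd_pow_le (μ : Measure ℕ) [IsProbabilityMeasure μ] (k : ℕ) :
    μ {k} • (π ⊗ₘ (Q ^ k)) ≤ π ⊗ₘ (timeSampled Q μ) := by
  refine Measure.le_iff.2 fun s hs => ?_
  rw [Measure.smul_apply, Measure.compProd_apply hs, Measure.compProd_apply hs, smul_eq_mul,
    ← lintegral_const_mul _ (Kernel.measurable_kernel_prodMk_left hs)]
  refine lintegral_mono fun x => ?_
  rw [timeSampled_apply Q μ x (measurable_prodMk_left hs)]
  exact ENNReal.le_tsum (f := fun k => μ {k} * (Q ^ k) x (Prod.mk x ⁻¹' s)) k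

/-- The time-sampled kernel is variance bounding as soon as one power `Q ^ k` that it samples
with positive probability has a right spectral gap. -/
theorem varianceBounding_timeSampled (hQ : Q.Invariant π) (μ : Measure ℕ)
    [IsProbabilityMeasure μ] {k : ℕ} (hk : μ {k} ≠ 0) {r : ℝ} (hr : r < 1)
    (hgap : ∀ f, ⟪f, centeredOp (invariant_pow hQ k) f⟫_ℝ ≤ r * ‖f‖ ^ 2) :
    VarianceBounding (timeSampled Q μ) π := by
  have hc : 0 < (μ {k}).toReal := ENNReal.toReal_pos hk (measure_ne_top μ _)
  refine varianceBounding_of_gap (invariant_timeSampled hQ μ)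
    (r := 1 - (μ {k}).toReal * (1 - r)) (by nlinarith) fun f => ?_
  refine (inner_centeredOp_le_of_smul_compProd_le (invariant_pow hQ k)
    (invariant_timeSampled hQ μ) prob_le_one (smul_compProd_pow_le μ k) f).trans ?_
  nlinarith [mul_le_mul_of_nonneg_left (hgap f) hc.le]

theorem exists_singleton_ne_zero {μ : Measure ℕ} {s : Set ℕ} (hs : μ s ≠ 0) :
    ∃ k ∈ s, μ {k} ≠ 0 := by
  by_contra! h
  refine hs ?_
  rw [← Set.biUnion_of_singleton s]
  exact (measure_biUnion_null_iff s.to_countable).2 h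

end TimeSampling

/-! ### Contraction from geometric ergodicity -/

section GeometricErgodicity

open scoped InnerProductSpace

variable {π : Measure X} [IsProbabilityMeasure π] {Q : Kernel X X} [IsMarkovKernel Q]

theorem abs_real_sub_real_le_tvDist (ν₁ ν₂ : Measure X) [IsProbabilityMeasure ν₁]
    [IsProbabilityMeasure ν₂] {s : Set X} (hs : MeasurableSet s) :
    |ν₁.real s - ν₂.real s| ≤ tvDist ν₁ ν₂ := by
  refine le_ciSup (f := fun A : {A : Set X // MeasurableSet A} => |ν₁.real A.1 - ν₂.real A.1|)
    ⟨1, ?_⟩ ⟨s, hs⟩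
  rintro _ ⟨A, rfl⟩
  have h1 := measureReal_nonneg (μ := ν₁) (s := A.1)
  have h2 := measureReal_nonneg (μ := ν₂) (s := A.1)
  have h3 := measureReal_le_one (μ := ν₁) (s := A.1)
  have h4 := measureReal_le_one (μ := ν₂) (s := A.1)
  exact abs_le.2 ⟨by linarith, by linarith⟩

/-- Geometric ergodicity is uniform on each of a sequence of measurable sets that cover `π`-almost
everything. The prefactor `M` need not be measurable, so the sets are measurable hulls of
`{M ≤ m}`; the rate passes to the hull for one measurable event at a time. -/
theorem GeometricallyErgodic.exists_uniform_cover (h : GeometricallyErgodic Q π) :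
    ∃ ρ : ℝ, 0 ≤ ρ ∧ ρ < 1 ∧ ∃ B : ℕ → Set X, (∀ m, MeasurableSet (B m)) ∧
      (∀ᵐ x ∂π, ∃ m, x ∈ B m) ∧ ∀ m n s, MeasurableSet s →
        ∀ᵐ x ∂π, x ∈ B m → |((Q ^ n) x).real s - π.real s| ≤ m * ρ ^ n := by
  obtain ⟨ρ, hρ0, hρ1, M, hM⟩ := h
  let A (m : ℕ) : Set X := {x | ∀ n, tvDist ((Q ^ n) x) π ≤ m * ρ ^ n}
  refine ⟨ρ, hρ0, hρ1, fun m => toMeasurable π (A m), fun m => measurableSet_toMeasurable _ _,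
    ?_, fun m n s hs => ?_⟩
  · filter_upwards [hM] with x hx
    obtain ⟨m, hm⟩ := exists_nat_ge (M x)
    refine ⟨m, subset_toMeasurable π _ fun n => (hx n).trans ?_⟩
    gcongr
  · have hmeas : MeasurableSet {x | m * ρ ^ n < |((Q ^ n) x).real s - π.real s|} := by
      refine measurableSet_lt measurable_const (Measurable.abs ?_)
      exact ((Q ^ n).measurable_coe hs).ennreal_toReal.sub_const _
    have hempty : A m ∩ {x | m * ρ ^ n < |((Q ^ n) x).real s - π.real s|} = ∅ := by
      refine Set.eq_empty_of_forall_notMem fun x hx => ?_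
      exact absurd (hx.1 n) (not_le.2 (lt_of_lt_of_le hx.2 (abs_real_sub_real_le_tvDist _ _ hs)))
    have hnull := Measure.measure_toMeasurable_inter hmeas (measure_ne_top π (A m))
    rw [hempty, measure_empty] at hnull
    filter_upwards [measure_eq_zero_iff_ae_notMem.1 hnull] with x hx hxB
    by_contra! hlt
    exact hx ⟨hxB, hlt⟩

theorem centeredOp_indicator_ae_eq (hQ : Q.Invariant π) {s : Set X} (hs : MeasurableSet s) :
    centeredOp hQ (indicatorConstLp 2 hs (measure_ne_top π s) (1 : ℝ)) =ᵐ[π]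
      fun x => (Q x).real s - π.real s := by
  set u : Lp ℝ 2 π := indicatorConstLp 2 hs (measure_ne_top π s) (1 : ℝ) with hu
  have hcoe : u =ᵐ[π] s.indicator fun _ => (1 : ℝ) := indicatorConstLp_coeFn
  have hmean : ⟪oneL2 π, u⟫_ℝ = π.real s := by
    rw [inner_oneL2, integral_congr_ae hcoe, integral_indicator_const _ hs, smul_eq_mul, mul_one]
  have hae : ∀ᵐ x ∂π, ∀ᵐ y ∂(Q x), u y = s.indicator (fun _ => (1 : ℝ)) y := by
    refine Measure.ae_ae_of_ae_comp ?_
    rwa [show Q ∘ₘ π = π from hQ]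
  have hone : oneL2 π =ᵐ[π] fun _ => (1 : ℝ) := Lp.coeFn_const _ _ _
  rw [centeredOp_apply, hmean]
  filter_upwards [Lp.coeFn_sub (kernelOp hQ u) (π.real s • oneL2 π),
    Lp.coeFn_smul (π.real s) (oneL2 π), hone, kernelOp_ae_eq hQ u, hae] with x h1 h2 h3 h4 h5
  rw [h1, Pi.sub_apply, h2, Pi.smul_apply, h3, h4, integral_congr_ae h5,
    integral_indicator_const _ hs, smul_eq_mul, smul_eq_mul, mul_one, mul_one]

/-- Indicators of measurable subsets of sets that cover almost everything span a dense subspace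
of `L²(π)`. -/
theorem topologicalClosure_span_indicator_eq_top {B : ℕ → Set X} (hB : ∀ m, MeasurableSet (B m))
    (hcover : ∀ᵐ x ∂π, ∃ m, x ∈ B m) :
    (Submodule.span ℝ {u : Lp ℝ 2 π | ∃ m, ∃ s, ∃ hs : MeasurableSet s, s ⊆ B m ∧
      u = indicatorConstLp 2 hs (measure_ne_top π s) (1 : ℝ)}).topologicalClosure = ⊤ := by
  rw [Submodule.topologicalClosure_eq_top_iff, Submodule.eq_bot_iff]
  intro g hg
  have hg0 (m : ℕ) : (B m).indicator g =ᵐ[π] 0 := by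
    refine Integrable.ae_eq_zero_of_forall_setIntegral_eq_zero
      (((Lp.memLp g).integrable one_le_two).indicator (hB m)) fun s hs _ => ?_
    rw [setIntegral_indicator (hB m),
      ← L2.inner_indicatorConstLp_one (hs.inter (hB m)) (measure_ne_top π _) g]
    exact (Submodule.mem_orthogonal _ _).1 hg _
      (Submodule.subset_span ⟨m, _, hs.inter (hB m), Set.inter_subset_right, rfl⟩)
  rw [Lp.eq_zero_iff_ae_eq_zero]
  filter_upwards [ae_all_iff.2 hg0, hcover] with x hx ⟨m, hm⟩
  simpa [hm] using hx m

/-- A geometrically ergodic reversible kernel contracts the functions of mean zero. For `u` in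
the span of indicators of subsets of the sets of uniform ergodicity, the correlations
`⟪u, Q ^ n u⟫` decay geometrically, and these `u` are dense. -/
theorem GeometricallyErgodic.exists_norm_centeredOp_le (hrev : Q.IsReversible π)
    (h : GeometricallyErgodic Q π) :
    ∃ ρ < 1, ∀ f, ‖centeredOp hrev.invariant f‖ ≤ ρ * ‖f‖ := by
  obtain ⟨ρ, hρ0, hρ1, B, hB, hcover, hrate⟩ := h.exists_uniform_cover
  refine ⟨ρ, hρ1, fun f => ?_⟩
  set C := centeredOp hrev.invariant with hC
  set V := Submodule.span ℝ {u : Lp ℝ 2 π | ∃ m, ∃ s, ∃ hs : MeasurableSet s, s ⊆ B m ∧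
    u = indicatorConstLp 2 hs (measure_ne_top π s) (1 : ℝ)} with hV
  have hdecay (u : Lp ℝ 2 π) (hu : u ∈ V) (v : Lp ℝ 2 π) (hv : v ∈ V) :
      ∃ K, ∀ n, |⟪u, (C ^ (n + 1)) v⟫_ℝ| ≤ K * ρ ^ (n + 1) := by
    induction hu, hv using Submodule.span_induction₂ with
    | mem_mem u v hu hv =>
      obtain ⟨m, s, hs, hsB, rfl⟩ := hu
      obtain ⟨-, t, ht, -, rfl⟩ := hv
      refine ⟨m, fun n => ?_⟩
      rw [L2.inner_indicatorConstLp_one, hC, ← centeredOp_pow]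
      have hle := norm_setIntegral_le_of_norm_le_const_ae' (measure_lt_top π s)
        (f := centeredOp (invariant_pow hrev.invariant (n + 1))
          (indicatorConstLp 2 ht (measure_ne_top π t) (1 : ℝ))) (C := m * ρ ^ (n + 1)) (by
          filter_upwards [centeredOp_indicator_ae_eq (invariant_pow hrev.invariant (n + 1)) ht,
            hrate m (n + 1) t ht] with x hx1 hx2 hxs
          rw [hx1]
          exact hx2 (hsB hxs))
      exact hle.trans (mul_le_of_le_one_right (by positivity) measureReal_le_one)
    | zero_left v hv => exact ⟨0, fun n => by simp⟩
    | zero_right u hu => exact ⟨0, fun n => by simp⟩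
    | add_left u u' v _ _ _ h₁ h₂ =>
      obtain ⟨K₁, h₁⟩ := h₁
      obtain ⟨K₂, h₂⟩ := h₂
      refine ⟨K₁ + K₂, fun n => ?_⟩
      rw [inner_add_left, add_mul]
      exact (abs_add_le _ _).trans (add_le_add (h₁ n) (h₂ n))
    | add_right u v v' _ _ _ h₁ h₂ =>
      obtain ⟨K₁, h₁⟩ := h₁
      obtain ⟨K₂, h₂⟩ := h₂
      refine ⟨K₁ + K₂, fun n => ?_⟩
      rw [map_add, inner_add_right, add_mul]
      exact (abs_add_le _ _).trans (add_le_add (h₁ n) (h₂ n))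
    | smul_left a u v _ _ h₁ =>
      obtain ⟨K, h₁⟩ := h₁
      refine ⟨|a| * K, fun n => ?_⟩
      rw [real_inner_smul_left, abs_mul, mul_assoc]
      exact mul_le_mul_of_nonneg_left (h₁ n) (abs_nonneg a)
    | smul_right a u v _ _ h₁ =>
      obtain ⟨K, h₁⟩ := h₁
      refine ⟨|a| * K, fun n => ?_⟩
      rw [map_smul, real_inner_smul_right, abs_mul, mul_assoc]
      exact mul_le_mul_of_nonneg_left (h₁ n) (abs_nonneg a)
  have hclosed : IsClosed {u : Lp ℝ 2 π | ‖C u‖ ≤ ρ * ‖u‖} :=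
    isClosed_le (by fun_prop) (by fun_prop)
  have hVsub : (V : Set (Lp ℝ 2 π)) ⊆ {u | ‖C u‖ ≤ ρ * ‖u‖} := fun u hu => by
    obtain ⟨K, hK⟩ := hdecay u hu u hu
    exact norm_apply_le_of_inner_pow_le (inner_centeredOp_comm hrev) hρ0
      fun n => (le_abs_self _).trans (hK n)
  have hf : f ∈ V.topologicalClosure := by
    rw [topologicalClosure_span_indicator_eq_top hB hcover]; trivial
  exact closure_minimal hVsub hclosed hf

end GeometricErgodicity

end TimeSampled

theorem theorem3 {X : Type*} [MeasurableSpace X]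
    (P : Kernel X X) [IsMarkovKernel P] (π : Measure X) [IsProbabilityMeasure π]
    (hrev : P.IsReversible π) (hvb : TimeSampled.VarianceBounding P π)
    (μ : Measure ℕ) [IsProbabilityMeasure μ]
    (hμ : 0 < μ {k : ℕ | Odd k} ∨
      (μ {0} < 1 ∧ TimeSampled.GeometricallyErgodic P π)) :
    TimeSampled.VarianceBounding (TimeSampled.timeSampled P μ) π := by
  open TimeSampled in
  rcases hμ with hodd | ⟨hμ0, hge⟩
  · obtain ⟨k, hk, hμk⟩ := exists_singleton_ne_zero hodd.ne'
    obtain ⟨r, hr, hgap⟩ := hvb.exists_gap hrev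
    obtain ⟨j, rfl⟩ : ∃ j, k = j + 1 := Nat.exists_eq_succ_of_ne_zero hk.pos.ne'
    refine varianceBounding_timeSampled hrev.invariant μ hμk (r := max r 0)
      (max_lt hr one_pos) fun f => ?_
    rw [centeredOp_pow hrev.invariant]
    refine inner_pow_odd_le (norm_centeredOp_le _) (inner_centeredOp_comm hrev)
      (le_max_right r 0) (fun g => (hgap g).trans ?_) hk f
    gcongr
    exact le_max_left r 0
  · have hpos : μ {0}ᶜ ≠ 0 := fun h => hμ0.ne ((prob_compl_eq_zero_iff (.singleton 0)).1 h)
    obtain ⟨k, hk, hμk⟩ := exists_singleton_ne_zero hpos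
    obtain ⟨ρ, hρ, hle⟩ := hge.exists_norm_centeredOp_le hrev
    obtain ⟨j, rfl⟩ : ∃ j, k = j + 1 := Nat.exists_eq_succ_of_ne_zero hk
    refine varianceBounding_timeSampled hrev.invariant μ hμk hρ fun f => ?_
    rw [centeredOp_pow hrev.invariant, pow_add_apply, pow_one]
    calc _ ≤ ‖f‖ * ‖(centeredOp hrev.invariant ^ j) (centeredOp hrev.invariant f)‖ :=
          real_inner_le_norm _ _
      _ ≤ ‖f‖ * (ρ * ‖f‖) := by
        gcongr
        exact (norm_pow_apply_le (norm_centeredOp_le _) j _).trans (hle f)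
      _ = ρ * ‖f‖ ^ 2 := by ring
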